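/- Let $A$ be a (complex, not necessarily unital) Banach algebra. A Banach $A$-bimodule is a Banach space $X$ with bounded bilinear actions $(a,x)\mapsto a\cdot x$ and $(x,a)\mapsto x\cdot a$ that make it an $A$-bimodule; its dual $X^*$ is a Banach $A$-bimodule through $\langle x,a\cdot f\rangle=\langle x\cdot a,f\rangle$ and $\langle x,f\cdot a\rangle=\langle a\cdot x,f\rangle$. A derivation $D:A\to X$ is a continuous linear map with $D(ab)=D(a)\cdot b+a\cdot D(b)$ for all $a,b\in A$; it is semi-inner if there are $\eta,\xi\in X$ with $D(a)=a\cdot\eta-\xi\cdot a$ for all $a\in A$. Let $A\widehat\otimes A$ be the projective tensor product, a Banach $A$-bimodule through $a\cdot(b\otimes c)=ab\otimes c$ and $(b\otimes c)\cdot a=b\otimes ca$, and let $\pi:A\widehat\otimes A\to A$ be the bounded linear map with $\pi(a\otimes b)=ab$. Biduals carry the iterated dual module structures, and $A$ is identified with its canonical image in $A^{**}$. The following are equivalent: (i) $A$ is semi-amenable, i.e. for each Banach $A$-bimodule $X$, every derivation from $A$ into $X^*$ is semi-inner. (ii) $A$ has right and left approximate semi-diagonals, i.e. there are bounded nets $(m_\alpha)$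 and $(n_\alpha)$ in $A\widehat\otimes A$, indexed by the same directed set, such that for each $a\in A$ $$a\,\pi(m_\alpha)\to a,\qquad \pi(n_\alpha)\,a\to a,\qquad a\cdot m_\alpha-n_\alpha\cdot a\to 0$$ in norm. (iii) $A$ has right and left virtual semi-diagonals, i.e. there are $M,N\in(A\widehat\otimes A)^{**}$ such that for each $a\in A$ $$a\cdot\pi^{**}(M)=a,\qquad \pi^{**}(N)\cdot a=a,\qquad a\cdot M=N\cdot a.$$ -/

import Mathlib

open Filter Topology
open scoped TensorProduct

universe u

noncomputable section


/-! ### Banach bimodules, derivations, semi-amenability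

Throughout, a (complex, not necessarily unital) Banach algebra is a type `A` with
`[NonUnitalNormedRing A] [NormedSpace ℂ A] [IsScalarTower ℂ A A] [SMulCommClass ℂ A A]
[CompleteSpace A]`. -/

/-- A Banach `A`-bimodule structure on the normed space `X`: two bounded bilinear actions
`lact a x = a · x` and `ract a x = x · a`, satisfying the bimodule laws.
Boundedness (joint continuity) of the actions is the fact that they are elements of
`A →L[ℂ] X →L[ℂ] X`. -/
structure BanachBimodule (A X : Type*) [NonUnitalNormedRing A] [NormedSpace ℂ A]
    [NormedAddCommGroup X] [NormedSpace ℂ X] where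
  /-- `lact a x` is `a · x`. -/
  lact : A →L[ℂ] X →L[ℂ] X
  /-- `ract a x` is `x · a`. -/
  ract : A →L[ℂ] X →L[ℂ] X
  lact_mul : ∀ (a b : A) (x : X), lact (a * b) x = lact a (lact b x)
  ract_mul : ∀ (a b : A) (x : X), ract (a * b) x = ract b (ract a x)
  lact_ract : ∀ (a b : A) (x : X), ract b (lact a x) = lact a (ract b x)

namespace BanachBimodule

variable {A X : Type*} [NonUnitalNormedRing A] [NormedSpace ℂ A]
  [NormedAddCommGroup X] [NormedSpace ℂ X]

/-- The dual bimodule `X*`, with `⟨x, a · f⟩ = ⟨x · a, f⟩` and `⟨x, f · a⟩ = ⟨a · x, f⟩`. -/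
def dual (B : BanachBimodule A X) : BanachBimodule A (StrongDual ℂ X) where
  lact := ((ContinuousLinearMap.compL ℂ X X ℂ).flip).comp B.ract
  ract := ((ContinuousLinearMap.compL ℂ X X ℂ).flip).comp B.lact
  lact_mul a b f := by ext x; simp [B.ract_mul]
  ract_mul a b f := by ext x; simp [B.lact_mul]
  lact_ract a b f := by ext x; simp [B.lact_ract]

theorem dual_lact_apply (B : BanachBimodule A X) (a : A) (f : StrongDual ℂ X) (x : X) :
    B.dual.lact a f x = f (B.ract a x) := rfl

theorem dual_ract_apply (B : BanachBimodule A X) (a : A) (f : StrongDual ℂ X) (x : X) :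
    B.dual.ract a f x = f (B.lact a x) := rfl

/-- A continuous linear map `D : A → X` is a derivation if `D (ab) = D a · b + a · D b`. -/
def IsDerivation (B : BanachBimodule A X) (D : A →L[ℂ] X) : Prop :=
  ∀ a b : A, D (a * b) = B.ract b (D a) + B.lact a (D b)

/-- `D` is semi-inner if there are `η, ξ ∈ X` with `D a = a · η - ξ · a` for all `a`. -/
def IsSemiInner (B : BanachBimodule A X) (D : A →L[ℂ] X) : Prop :=
  ∃ η ξ : X, ∀ a : A, D a = B.lact a η - B.ract a ξ

variable (A) in
/-- `A` as a Banach bimodule over itself, with `a · x = a * x` and `x · a = x * a`. -/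
def self [IsScalarTower ℂ A A] [SMulCommClass ℂ A A] : BanachBimodule A A where
  lact := ContinuousLinearMap.mul ℂ A
  ract := (ContinuousLinearMap.mul ℂ A).flip
  lact_mul a b x := by simp [mul_assoc]
  ract_mul a b x := by simp [mul_assoc]
  lact_ract a b x := by simp [mul_assoc]

end BanachBimodule

/-- `A` is semi-amenable if, for each Banach `A`-bimodule `X`, every continuous derivation
from `A` into the dual bimodule `X*` is semi-inner. -/
def IsSemiAmenable (A : Type u) [NonUnitalNormedRing A] [NormedSpace ℂ A] : Prop :=
  ∀ (X : Type u) [NormedAddCommGroup X] [NormedSpace ℂ X] [CompleteSpace X]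
    (B : BanachBimodule A X) (D : A →L[ℂ] StrongDual ℂ X),
    B.dual.IsDerivation D → B.dual.IsSemiInner D

/-! ### The projective tensor square -/

/-- The projective tensor product of `A` with itself: the completion of the algebraic tensor
product of two copies of `A` for the projective norm, which is the norm that `⨂[ℂ] _ : Fin 2, A`
carries as a normed space. -/
def ProjTensorSq (A : Type u) [NonUnitalNormedRing A] [NormedSpace ℂ A] : Type u :=
  UniformSpace.Completion (⨂[ℂ] _ : Fin 2, A)

namespace ProjTensorSq

variable {A : Type u} [NonUnitalNormedRing A] [NormedSpace ℂ A]
variable {Y : Type*} [NormedAddCommGroup Y] [NormedSpace ℂ Y]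

instance : NormedAddCommGroup (ProjTensorSq A) :=
  inferInstanceAs (NormedAddCommGroup (UniformSpace.Completion (⨂[ℂ] _ : Fin 2, A)))

instance : NormedSpace ℂ (ProjTensorSq A) :=
  inferInstanceAs (NormedSpace ℂ (UniformSpace.Completion (⨂[ℂ] _ : Fin 2, A)))

instance : CompleteSpace (ProjTensorSq A) :=
  inferInstanceAs (CompleteSpace (UniformSpace.Completion (⨂[ℂ] _ : Fin 2, A)))

variable (A) in
/-- The canonical isometry of the algebraic tensor product into its completion. -/
def ofAlg : (⨂[ℂ] _ : Fin 2, A) →L[ℂ] ProjTensorSq A :=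
  UniformSpace.Completion.toComplL (𝕜 := ℂ) (E := ⨂[ℂ] _ : Fin 2, A)

theorem norm_ofAlg (t : ⨂[ℂ] _ : Fin 2, A) : ‖ofAlg A t‖ = ‖t‖ :=
  UniformSpace.Completion.norm_coe t

theorem denseRange_ofAlg : DenseRange (ofAlg A) :=
  UniformSpace.Completion.denseRange_coe

theorem isUniformInducing_ofAlg : IsUniformInducing (ofAlg A) :=
  UniformSpace.Completion.isUniformInducing_coe _

/-- A bounded bilinear map, seen as a continuous multilinear map in two variables. -/
def multi {Y : Type*} [NormedAddCommGroup Y] [NormedSpace ℂ Y] (f : A →L[ℂ] A →L[ℂ] Y) :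
    ContinuousMultilinearMap ℂ (fun _ : Fin 2 => A) Y :=
  MultilinearMap.mkContinuous
    { toFun := fun m => f (m 0) (m 1)
      map_update_add' := by
        intro _ m i x y
        fin_cases i <;> simp [Function.update]
      map_update_smul' := by
        intro _ m i c x
        fin_cases i <;> simp [Function.update] } ‖f‖ (by
      intro m
      simpa [Fin.prod_univ_two, mul_assoc] using f.le_opNorm₂ (m 0) (m 1))

/-- The elementary tensor `a ⊗ b`. -/
def tmul (a b : A) : ProjTensorSq A :=
  ofAlg A (PiTensorProduct.tprod ℂ ![a, b])

theorem norm_tmul_le (a b : A) : ‖tmul a b‖ ≤ ‖a‖ * ‖b‖ := by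
  rw [tmul, norm_ofAlg]
  simpa [Fin.prod_univ_two] using
    PiTensorProduct.projectiveSeminorm_tprod_le (𝕜 := ℂ) (E := fun _ : Fin 2 => A) ![a, b]

theorem update_zero {A : Type*} (a b x : A) : Function.update ![a, b] 0 x = ![x, b] := by
  ext i; fin_cases i <;> rfl

theorem update_one {A : Type*} (a b x : A) : Function.update ![a, b] 1 x = ![a, x] := by
  ext i; fin_cases i <;> rfl

variable (A) in
/-- `(a, b) ↦ a ⊗ b` as a bounded bilinear map. -/
def tmulL : A →L[ℂ] A →L[ℂ] ProjTensorSq A :=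
  LinearMap.mkContinuous₂
    (LinearMap.mk₂ ℂ tmul
      (fun a a' b => by
        have h := (PiTensorProduct.tprod ℂ (s := fun _ : Fin 2 => A)).map_update_add ![0, b] 0 a a'
        rw [update_zero, update_zero, update_zero] at h
        rw [tmul, h, map_add]; rfl)
      (fun c a b => by
        have h := (PiTensorProduct.tprod ℂ (s := fun _ : Fin 2 => A)).map_update_smul ![0, b] 0 c a
        rw [update_zero, update_zero] at h
        rw [tmul, h, map_smul]; rfl)
      (fun a b b' => by
        have h := (PiTensorProduct.tprod ℂ (s := fun _ : Fin 2 => A)).map_update_add ![a, 0] 1 b b'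
        rw [update_one, update_one, update_one] at h
        rw [tmul, h, map_add]; rfl)
      (fun c a b => by
        have h := (PiTensorProduct.tprod ℂ (s := fun _ : Fin 2 => A)).map_update_smul ![a, 0] 1 c b
        rw [update_one, update_one] at h
        rw [tmul, h, map_smul]; rfl))
    1 (fun a b => by simpa using norm_tmul_le a b)

theorem tmulL_apply (a b : A) : tmulL A a b = tmul a b := rfl

/-- Two continuous linear maps on the projective tensor square that agree on elementary tensors
are equal. -/
theorem hom_ext {f g : ProjTensorSq A →L[ℂ] Y} (h : ∀ a b, f (tmul a b) = g (tmul a b)) :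
    f = g := by
  have key : f.comp (ofAlg A) = g.comp (ofAlg A) := by
    apply ContinuousLinearMap.coe_injective
    refine PiTensorProduct.ext ?_
    ext m
    have hm : m = ![m 0, m 1] := by ext i; fin_cases i <;> rfl
    rw [hm]
    exact h (m 0) (m 1)
  exact DFunLike.coe_injective <| denseRange_ofAlg.equalizer f.continuous g.continuous <|
    funext fun t => DFunLike.congr_fun key t

variable [CompleteSpace Y]

/-- The linearization of a bounded bilinear map `f` on `A × A`, see `lift_tmul`. -/
def lift (f : A →L[ℂ] A →L[ℂ] Y) : ProjTensorSq A →L[ℂ] Y :=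
  (PiTensorProduct.liftIsometry ℂ (fun _ : Fin 2 => A) Y (multi f)).extend (ofAlg A)

theorem lift_ofAlg (f : A →L[ℂ] A →L[ℂ] Y) (t : ⨂[ℂ] _ : Fin 2, A) :
    lift f (ofAlg A t) = PiTensorProduct.liftIsometry ℂ _ Y (multi f) t :=
  ContinuousLinearMap.extend_eq _ denseRange_ofAlg isUniformInducing_ofAlg t

theorem lift_tmul (f : A →L[ℂ] A →L[ℂ] Y) (a b : A) : lift f (tmul a b) = f a b := by
  rw [tmul, lift_ofAlg]
  simp [multi]

theorem norm_lift_le (f : A →L[ℂ] A →L[ℂ] Y) : ‖lift f‖ ≤ ‖f‖ := by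
  refine ContinuousLinearMap.opNorm_le_bound (lift f) (norm_nonneg f) fun x => ?_
  refine denseRange_ofAlg.induction_on x
    (isClosed_le (lift f).continuous.norm (continuous_const.mul continuous_norm)) fun t => ?_
  rw [lift_ofAlg, norm_ofAlg, PiTensorProduct.liftIsometry_apply_apply]
  refine (PiTensorProduct.norm_eval_le_projectiveSeminorm (multi f) t).trans ?_
  gcongr
  exact MultilinearMap.mkContinuous_norm_le _ (norm_nonneg f) _

variable (A Y) in
/-- `lift` as a linear map. -/
def liftLin : (A →L[ℂ] A →L[ℂ] Y) →ₗ[ℂ] (ProjTensorSq A →L[ℂ] Y) where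
  toFun := lift
  map_add' f g := by
    refine hom_ext fun a b => ?_
    change lift (f + g) (tmul a b) = lift f (tmul a b) + lift g (tmul a b)
    rw [lift_tmul, lift_tmul, lift_tmul]
    rfl
  map_smul' c f := by
    refine hom_ext fun a b => ?_
    change lift (c • f) (tmul a b) = c • lift f (tmul a b)
    rw [lift_tmul, lift_tmul]
    rfl

variable (A Y) in
/-- `lift` as a continuous linear map. -/
def liftL : (A →L[ℂ] A →L[ℂ] Y) →L[ℂ] (ProjTensorSq A →L[ℂ] Y) :=
  (liftLin A Y).mkContinuous 1 (fun f : A →L[ℂ] A →L[ℂ] Y => by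
    rw [one_mul]
    exact norm_lift_le (A := A) (Y := Y) f)

theorem liftL_tmul (f : A →L[ℂ] A →L[ℂ] Y) (a b : A) : liftL A Y f (tmul a b) = f a b :=
  lift_tmul f a b

variable (A) [IsScalarTower ℂ A A] [SMulCommClass ℂ A A]

/-- The left action of `A`, given by `a · (b ⊗ c) = ab ⊗ c`. -/
def lact : A →L[ℂ] ProjTensorSq A →L[ℂ] ProjTensorSq A :=
  (liftL A (ProjTensorSq A)).comp
    ((ContinuousLinearMap.compL ℂ A A (A →L[ℂ] ProjTensorSq A) (tmulL A)).comp
      (ContinuousLinearMap.mul ℂ A))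

/-- The right action of `A`, given by `(b ⊗ c) · a = b ⊗ ca`; the algebra element is the first
argument. -/
def ract : A →L[ℂ] ProjTensorSq A →L[ℂ] ProjTensorSq A :=
  (liftL A (ProjTensorSq A)).comp
    (((ContinuousLinearMap.compL ℂ A (A →L[ℂ] ProjTensorSq A)
        (A →L[ℂ] ProjTensorSq A)).flip (tmulL A)).comp
      ((ContinuousLinearMap.compL ℂ A A (ProjTensorSq A)).flip.comp
        (ContinuousLinearMap.mul ℂ A).flip))

variable {A}

theorem lact_tmul (a b c : A) : lact A a (tmul b c) = tmul (a * b) c :=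
  liftL_tmul _ b c

theorem ract_tmul (a b c : A) : ract A a (tmul b c) = tmul b (c * a) :=
  liftL_tmul _ b c

variable (A)

/-- The Banach `A`-bimodule structure of the projective tensor square. -/
def bimodule : BanachBimodule A (ProjTensorSq A) where
  lact := lact A
  ract := ract A
  lact_mul a b x := by
    have : lact A (a * b) = (lact A a).comp (lact A b) :=
      hom_ext fun c d => by simp [lact_tmul, mul_assoc]
    exact DFunLike.congr_fun this x
  ract_mul a b x := by
    have : ract A (a * b) = (ract A b).comp (ract A a) :=
      hom_ext fun c d => by simp [ract_tmul, mul_assoc]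
    exact DFunLike.congr_fun this x
  lact_ract a b x := by
    have : (ract A b).comp (lact A a) = (lact A a).comp (ract A b) :=
      hom_ext fun c d => by simp [lact_tmul, ract_tmul]
    exact DFunLike.congr_fun this x

variable [CompleteSpace A]

/-- The product map `π`, given by `π (a ⊗ b) = ab`. -/
def prodMap : ProjTensorSq A →L[ℂ] A :=
  lift (ContinuousLinearMap.mul ℂ A)

theorem prodMap_tmul (a b : A) : prodMap A (tmul a b) = a * b :=
  lift_tmul _ a b

/-- The second adjoint `π**` of the product map, given by `⟨f, π** M⟩ = ⟨f ∘ π, M⟩`. -/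
def prodMapBidual : StrongDual ℂ (StrongDual ℂ (ProjTensorSq A)) →L[ℂ]
    StrongDual ℂ (StrongDual ℂ A) :=
  ((prodMap A).precomp ℂ).precomp ℂ

theorem prodMapBidual_apply (M : StrongDual ℂ (StrongDual ℂ (ProjTensorSq A)))
    (f : StrongDual ℂ A) : prodMapBidual A M f = M (f.comp (prodMap A)) := rfl

end ProjTensorSq

/-! ### Semi-diagonals -/

section SemiDiagonals

variable (A : Type u) [NonUnitalNormedRing A] [NormedSpace ℂ A] [IsScalarTower ℂ A A]
  [SMulCommClass ℂ A A] [CompleteSpace A]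

open ProjTensorSq

/-- `A` has (right and left) approximate semi-diagonals: there are bounded nets `m`, `n` in the
projective tensor square, over a common directed set, such that `a π(m_i) → a`, `π(n_i) a → a`
and `a · m_i - n_i · a → 0` in norm, for each `a`. -/
def HasApproxSemiDiagonals : Prop :=
  ∃ (ι : Type u) (_ : Preorder ι) (_ : IsDirectedOrder ι) (_ : Nonempty ι)
    (m n : ι → ProjTensorSq A),
    (∃ C : ℝ, ∀ i, ‖m i‖ ≤ C) ∧ (∃ C : ℝ, ∀ i, ‖n i‖ ≤ C) ∧
    ∀ a : A,
      Tendsto (fun i => a * prodMap A (m i)) atTop (𝓝 a) ∧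
      Tendsto (fun i => prodMap A (n i) * a) atTop (𝓝 a) ∧
      Tendsto (fun i => (bimodule A).lact a (m i) - (bimodule A).ract a (n i)) atTop (𝓝 0)

/-- `A` has (right and left) virtual semi-diagonals: there are `M`, `N` in the bidual of the
projective tensor square with `a π**(M) = a`, `π**(N) a = a` and `a · M = N · a` for each `a`.
The module actions are the bidual ones, and `a` on the right-hand sides is its canonical image
in the bidual of `A`. -/
def HasVirtualSemiDiagonals : Prop :=
  ∃ M N : StrongDual ℂ (StrongDual ℂ (ProjTensorSq A)),
    ∀ a : A,
      (BanachBimodule.self A).dual.dual.lact a (prodMapBidual A M) =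
        NormedSpace.inclusionInDoubleDual ℂ A a ∧
      (BanachBimodule.self A).dual.dual.ract a (prodMapBidual A N) =
        NormedSpace.inclusionInDoubleDual ℂ A a ∧
      (bimodule A).dual.dual.lact a M = (bimodule A).dual.dual.ract a N

end SemiDiagonals

end

/-! Write `π` for `prodMap A`. Virtual and approximate semi-diagonals correspond by weak-star
ultrafilter limits in one direction and Helly's lemma in the other.

Given `M`, `N` and a derivation `D` into `X*`, apply the second adjoint of `Φ (b ⊗ c) = b · D c` to
`a · M = N · a`. Since `X` may be degenerate, this represents only `E ∘ D` as semi-inner, where `E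
f` is the weak-star limit of `π(n) · f`. The remainder `D - E ∘ D` is a right module map, and
testing it against `N` shows that it is right multiplication by a fixed functional.

Conversely, semi-amenability applied to the embedding `A → A**`, with one action made trivial, gives
one-sided identities in `A**`. They combine into a two-sided `G`, and `M₀ = G ⊗ G` satisfies both
product identities. The derivation `a · M₀ - M₀ · a` takes values in the kernel of `π**`, a dual
bimodule, so it equals `a · η - ξ · a` there; take `M = M₀ - η`, `N = M₀ - ξ`. -/

noncomputable section

/-! ### Passing between a space and its bidual -/

/-- **Helly's lemma**: if a bidual element `W` formally solves `T z = c`, then the equation has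
approximate solutions in the ball of radius `‖W‖`. -/
theorem exists_norm_le_norm_sub_lt_of_bidual {Z E : Type*} [NormedAddCommGroup Z] [NormedSpace ℂ Z]
    [NormedAddCommGroup E] [NormedSpace ℂ E] (T : Z →L[ℂ] E) (W : StrongDual ℂ (StrongDual ℂ Z))
    (c : E) (h : ∀ ψ : StrongDual ℂ E, W (ψ.comp T) = ψ c) {ε : ℝ} (hε : 0 < ε) :
    ∃ z, ‖z‖ ≤ ‖W‖ ∧ ‖T z - c‖ < ε := by
  set s : Set E := T '' Metric.closedBall 0 ‖W‖ with hs
  suffices hc : c ∈ closure s by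
    obtain ⟨_, ⟨z, hz, rfl⟩, hd⟩ := Metric.mem_closure_iff.1 hc ε hε
    refine ⟨z, by simpa using hz, ?_⟩
    rwa [dist_comm, dist_eq_norm] at hd
  by_contra hc
  let _ : NormedSpace ℝ Z := NormedSpace.restrictScalars ℝ ℂ Z
  let _ : NormedSpace ℝ E := NormedSpace.restrictScalars ℝ ℂ E
  have hconv : Convex ℝ s := (convex_closedBall (0 : Z) ‖W‖).is_linear_image
    ⟨T.map_add, fun r x => T.map_smul (r : ℂ) x⟩
  obtain ⟨φ, r, h1, h2⟩ := RCLike.geometric_hahn_banach_closed_point (𝕜 := ℂ)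
    hconv.closure isClosed_closure hc
  have hr : 0 < r := by
    simpa using h1 0 (subset_closure ⟨0, Metric.mem_closedBall_self (norm_nonneg W), by simp⟩)
  have hbound : ‖W‖ * ‖φ.comp T‖ ≤ r := by
    -- The operator norm bound divides by the radius of the ball, so radius zero is separate.
    rcases (norm_nonneg W).eq_or_lt with h0 | h0
    · rw [← h0, zero_mul]; exact hr.le
    rw [← le_div_iff₀' h0]
    refine ContinuousLinearMap.opNorm_bound_of_ball_bound h0 r _ fun z hz => ?_
    -- Rotating `z` by a unimodular scalar turns the bound on the real part into one on the modulus.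
    obtain ⟨u, hu, huz⟩ := RCLike.exists_norm_eq_mul_self (φ (T z))
    have h4 := h1 (T (u • z)) (subset_closure ⟨u • z, by simpa [norm_smul, hu] using hz, rfl⟩)
    rw [T.map_smul, φ.map_smul, smul_eq_mul, ← huz] at h4
    simpa using h4.le
  have h3 : RCLike.re (φ c) ≤ ‖W‖ * ‖φ.comp T‖ := by
    rw [← h φ]
    exact (RCLike.re_le_norm _).trans (W.le_opNorm _)
  linarith

/-- Bounded families have weak-star limits in the bidual along ultrafilters. -/
theorem exists_bidual_tendsto {P : Type*} [NormedAddCommGroup P] [NormedSpace ℂ P] {ι : Type*}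
    (U : Ultrafilter ι) (m : ι → P) (C : ℝ) (hC : ∀ i, ‖m i‖ ≤ C) :
    ∃ M : StrongDual ℂ (StrongDual ℂ P),
    ∀ F : StrongDual ℂ P, Tendsto (fun i => F (m i)) U (𝓝 (M F)) := by
  let j : ι → WeakDual ℂ (StrongDual ℂ P) :=
    fun i => StrongDual.toWeakDual (NormedSpace.inclusionInDoubleDual ℂ P (m i))
  have hK := WeakDual.isCompact_closedBall (𝕜 := ℂ) (0 : StrongDual ℂ (StrongDual ℂ P)) C
  obtain ⟨M, -, hM⟩ := hK.ultrafilter_le_nhds (U.map j) (by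
    rw [Ultrafilter.coe_map, le_principal_iff, mem_map]
    refine univ_mem' fun i => ?_
    simpa [j] using (NormedSpace.double_dual_bound ℂ P (m i)).trans (hC i))
  refine ⟨WeakDual.toStrongDual M, fun F => ?_⟩
  exact ((WeakDual.eval_continuous F).tendsto M).comp hM

/-! ### Quotient and one-sided bimodules -/

namespace Submodule

/-- Descend a bounded bilinear map that vanishes on `S` in the second variable to the quotient. -/
def liftQL₂ {A X Y : Type*} [NormedAddCommGroup A] [NormedSpace ℂ A]
    [NormedAddCommGroup X] [NormedSpace ℂ X] [NormedAddCommGroup Y] [NormedSpace ℂ Y]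
    (S : Submodule ℂ X) [IsClosed (S : Set X)] (T : A →L[ℂ] X →L[ℂ] Y)
    (h : ∀ a, ∀ s ∈ S, T a s = 0) : A →L[ℂ] (X ⧸ S) →L[ℂ] Y :=
  ContinuousLinearMap.flip (S.liftQL T.flip fun s hs => by ext a; exact h a s hs)

end Submodule

namespace BanachBimodule

variable {A X : Type*} [NonUnitalNormedRing A] [NormedSpace ℂ A]
  [NormedAddCommGroup X] [NormedSpace ℂ X]

/-- The quotient of a Banach bimodule by a closed sub-bimodule. -/
def quotient (B : BanachBimodule A X) (S : Submodule ℂ X) [IsClosed (S : Set X)]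
    (hl : ∀ a, ∀ s ∈ S, B.lact a s ∈ S) (hr : ∀ a, ∀ s ∈ S, B.ract a s ∈ S) :
    BanachBimodule A (X ⧸ S) where
  lact := S.liftQL₂ ((ContinuousLinearMap.compL ℂ X X (X ⧸ S) S.mkQL).comp B.lact)
    fun a s hs => (Submodule.Quotient.mk_eq_zero S).2 (hl a s hs)
  ract := S.liftQL₂ ((ContinuousLinearMap.compL ℂ X X (X ⧸ S) S.mkQL).comp B.ract)
    fun a s hs => (Submodule.Quotient.mk_eq_zero S).2 (hr a s hs)
  lact_mul a b x := by
    obtain ⟨x, rfl⟩ := S.mkQ_surjective x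
    exact congrArg S.mkQL (B.lact_mul a b x)
  ract_mul a b x := by
    obtain ⟨x, rfl⟩ := S.mkQ_surjective x
    exact congrArg S.mkQL (B.ract_mul a b x)
  lact_ract a b x := by
    obtain ⟨x, rfl⟩ := S.mkQ_surjective x
    exact congrArg S.mkQL (B.lact_ract a b x)

/-- The bimodule with the left action of `B` and trivial right action. -/
def leftPart (B : BanachBimodule A X) : BanachBimodule A X where
  lact := B.lact
  ract := 0
  lact_mul := B.lact_mul
  ract_mul a b x := by simp
  lact_ract a b x := by simp

/-- The bimodule with the right action of `B` and trivial left action. -/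
def rightPart (B : BanachBimodule A X) : BanachBimodule A X where
  lact := 0
  ract := B.ract
  lact_mul a b x := by simp
  ract_mul := B.ract_mul
  lact_ract a b x := by simp

/-- The bounded bilinear map `(b, c) ↦ b · D c`. -/
def lactDeriv (B : BanachBimodule A X) (D : A →L[ℂ] X) : A →L[ℂ] A →L[ℂ] X :=
  ((ContinuousLinearMap.compL ℂ A X X).flip D).comp B.lact

end BanachBimodule

/-! ### Tensors of bidual elements and equivariance of the product map -/

namespace ProjTensorSq

variable {A : Type u} [NonUnitalNormedRing A] [NormedSpace ℂ A]

/-- The tensor `U ⊗ V` of two bidual elements, given by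
`⟨φ, U ⊗ V⟩ = ⟨a ↦ ⟨b ↦ φ (a ⊗ b), V⟩, U⟩`. -/
def bidualTmul (U V : StrongDual ℂ (StrongDual ℂ A)) :
    StrongDual ℂ (StrongDual ℂ (ProjTensorSq A)) :=
  U.comp ((ContinuousLinearMap.compL ℂ A (StrongDual ℂ A) ℂ V).comp
    (((ContinuousLinearMap.compL ℂ A (A →L[ℂ] ProjTensorSq A) (StrongDual ℂ A)).flip
      (tmulL A)).comp (ContinuousLinearMap.compL ℂ A (ProjTensorSq A) ℂ)))

variable [IsScalarTower ℂ A A] [SMulCommClass ℂ A A]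

theorem prodMap_lact [CompleteSpace A] (a : A) (t : ProjTensorSq A) :
    prodMap A ((bimodule A).lact a t) = a * prodMap A t := by
  have : (prodMap A).comp (lact A a) = (ContinuousLinearMap.mul ℂ A a).comp (prodMap A) :=
    hom_ext fun b c => by simp [lact_tmul, prodMap_tmul, mul_assoc]
  exact DFunLike.congr_fun this t

theorem prodMap_ract [CompleteSpace A] (a : A) (t : ProjTensorSq A) :
    prodMap A ((bimodule A).ract a t) = prodMap A t * a := by
  have : (prodMap A).comp (ract A a) =
      ((ContinuousLinearMap.mul ℂ A).flip a).comp (prodMap A) :=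
    hom_ext fun b c => by simp [ract_tmul, prodMap_tmul, mul_assoc]
  exact DFunLike.congr_fun this t

theorem prodMapBidual_lact [CompleteSpace A] (a : A)
    (M : StrongDual ℂ (StrongDual ℂ (ProjTensorSq A))) :
    prodMapBidual A ((bimodule A).dual.dual.lact a M) =
      (BanachBimodule.self A).dual.dual.lact a (prodMapBidual A M) := by
  ext f
  refine congrArg M ?_
  ext t
  exact congrArg f (prodMap_lact a t)

theorem prodMapBidual_ract [CompleteSpace A] (a : A)
    (M : StrongDual ℂ (StrongDual ℂ (ProjTensorSq A))) :
    prodMapBidual A ((bimodule A).dual.dual.ract a M) =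
      (BanachBimodule.self A).dual.dual.ract a (prodMapBidual A M) := by
  ext f
  refine congrArg M ?_
  ext t
  exact congrArg f (prodMap_ract a t)

end ProjTensorSq

open ProjTensorSq

/-! ### Consequences of semi-diagonals -/

section

variable {A : Type u} [NonUnitalNormedRing A] [NormedSpace ℂ A] [IsScalarTower ℂ A A]
  [SMulCommClass ℂ A A] [CompleteSpace A]

theorem HasVirtualSemiDiagonals.isSemiAmenable (h : HasVirtualSemiDiagonals A) :
    IsSemiAmenable A := by
  obtain ⟨M, N, hMN⟩ := h
  intro X _ _ _ B D hD
  let Φ : ProjTensorSq A →L[ℂ] StrongDual ℂ X := lift (B.dual.lactDeriv D)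
  have hΦ : ∀ b c, Φ (tmul b c) = B.dual.lact b (D c) := fun b c => lift_tmul _ b c
  have hΦl : ∀ a t, Φ ((bimodule A).lact a t) = B.dual.lact a (Φ t) := by
    intro a t
    have : Φ.comp (lact A a) = (B.dual.lact a).comp Φ := hom_ext fun b c => by
      simp [lact_tmul, hΦ, B.dual.lact_mul]
    exact DFunLike.congr_fun this t
  -- `Φ` fails to be a right module map exactly by the Leibniz term `b · (c · D a)`.
  have hΦr : ∀ a t, B.dual.ract a (Φ t) =
      Φ ((bimodule A).ract a t) - B.dual.lact (prodMap A t) (D a) := by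
    intro a t
    have : (B.dual.ract a).comp Φ =
        Φ.comp (ract A a) - (B.dual.lact.flip (D a)).comp (prodMap A) := hom_ext fun b c => by
      simp [ract_tmul, hΦ, hD c a, B.dual.lact_mul, B.dual.lact_ract, prodMap_tmul]
    exact DFunLike.congr_fun this t
  have hN' : ∀ (a : A) (g : StrongDual ℂ A) (G : StrongDual ℂ (ProjTensorSq A)),
      (∀ t, G t = g (prodMap A t * a)) → N G = g a := by
    intro a g G hG
    have := DFunLike.congr_fun (hMN a).2.1 g
    refine Eq.trans (congrArg N ?_) this
    ext t
    exact hG t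
  have hM : ∀ (a : A) (G : StrongDual ℂ (ProjTensorSq A)),
      M (G.comp ((bimodule A).lact a)) = N (G.comp ((bimodule A).ract a)) :=
    fun a G => DFunLike.congr_fun (hMN a).2.2 G
  -- Left multiplication by `π**(N)`: it fixes every `a · f` and commutes with the right action.
  let E : StrongDual ℂ X →L[ℂ] StrongDual ℂ X :=
    (ContinuousLinearMap.compL ℂ X (StrongDual ℂ (ProjTensorSq A)) ℂ N).comp
      ((ContinuousLinearMap.flipₗᵢ ℂ (ProjTensorSq A) X ℂ :
        (ProjTensorSq A →L[ℂ] X →L[ℂ] ℂ) →L[ℂ] (X →L[ℂ] ProjTensorSq A →L[ℂ] ℂ)).comp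
      (((ContinuousLinearMap.compL ℂ (ProjTensorSq A) A (StrongDual ℂ X)).flip (prodMap A)).comp
        B.dual.lact.flip))
  have hE : ∀ f, E f = N.comp ((B.dual.lact.flip f).comp (prodMap A)).flip := fun f => rfl
  have hEl : ∀ a f, E (B.dual.lact a f) = B.dual.lact a f := by
    intro a f
    ext x
    refine hN' a (B.dual.lact.flip f |>.flip x) _ fun t => ?_
    change B.dual.lact (prodMap A t) (B.dual.lact a f) x = B.dual.lact (prodMap A t * a) f x
    rw [B.dual.lact_mul]
  have hEr : ∀ a f, E (B.dual.ract a f) = B.dual.ract a (E f) := by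
    intro a f
    ext x
    refine congrArg N ?_
    ext t
    change B.dual.lact (prodMap A t) (B.dual.ract a f) x =
      B.dual.ract a (B.dual.lact (prodMap A t) f) x
    rw [B.dual.lact_ract]
  let D' : A →L[ℂ] StrongDual ℂ X := D - E.comp D
  have hD' : ∀ a b, D' (a * b) = B.dual.ract b (D' a) := by
    intro a b
    simp [D', hD a b, hEl, hEr]
  -- Heuristically `D' a = lim D' (π(n) a) = (lim D' (π(n))) · a`.
  have key1 : ∀ a, D' a = B.dual.ract a (N.comp (D'.comp (prodMap A)).flip) := by
    intro a
    ext x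
    refine (hN' a (D'.flip x) _ fun t => ?_).symm
    change D' (prodMap A t) (B.lact a x) = D' (prodMap A t * a) x
    rw [hD']
    rfl
  -- Heuristically `a · lim Φ(m) = lim Φ(n · a) = (lim Φ(n)) · a + lim π(n) · D a`.
  have key2 : ∀ a, E (D a) =
      B.dual.lact a (M.comp Φ.flip) - B.dual.ract a (N.comp Φ.flip) := by
    intro a
    ext x
    have e1 : (B.dual.lact a (M.comp Φ.flip)) x = M ((Φ.flip x).comp ((bimodule A).lact a)) := by
      refine congrArg M ?_
      ext t
      exact (DFunLike.congr_fun (hΦl a t) x).symm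
    have e2 : (B.dual.ract a (N.comp Φ.flip)) x =
        N ((Φ.flip x).comp ((bimodule A).ract a)) - E (D a) x := by
      rw [hE]
      refine Eq.trans (congrArg N ?_) (map_sub N _ _)
      ext t
      exact DFunLike.congr_fun (hΦr a t) x
    rw [sub_apply, e1, e2, hM]
    ring
  refine ⟨M.comp Φ.flip, N.comp Φ.flip - N.comp (D'.comp (prodMap A)).flip, fun a => ?_⟩
  have : D a = D' a + E (D a) := by simp [D']
  rw [this, key2, map_sub, ← key1]
  abel

/-- Both limits are taken along the same ultrafilter, so the condition coupling the two nets
survives. -/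
theorem HasApproxSemiDiagonals.hasVirtualSemiDiagonals (h : HasApproxSemiDiagonals A) :
    HasVirtualSemiDiagonals A := by
  obtain ⟨ι, _, _, _, m, n, ⟨C, hC⟩, ⟨C', hC'⟩, h⟩ := h
  let U : Ultrafilter ι := Ultrafilter.of atTop
  have hU : (U : Filter ι) ≤ atTop := Ultrafilter.of_le _
  obtain ⟨M, hM⟩ := exists_bidual_tendsto U m C hC
  obtain ⟨N, hN⟩ := exists_bidual_tendsto U n C' hC'
  refine ⟨M, N, fun a => ⟨?_, ?_, ?_⟩⟩
  · ext f
    exact tendsto_nhds_unique (hM ((f.comp (ContinuousLinearMap.mul ℂ A a)).comp (prodMap A)))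
      ((f.continuous.tendsto a).comp ((h a).1.mono_left hU))
  · ext f
    exact tendsto_nhds_unique
      (hN ((f.comp ((ContinuousLinearMap.mul ℂ A).flip a)).comp (prodMap A)))
      ((f.continuous.tendsto a).comp ((h a).2.1.mono_left hU))
  · ext F
    refine sub_eq_zero.1 <| tendsto_nhds_unique
      ((hM (F.comp ((bimodule A).lact a))).sub (hN (F.comp ((bimodule A).ract a)))) ?_
    have := (F.continuous.tendsto 0).comp ((h a).2.2.mono_left hU)
    simpa [Function.comp_def] using this

theorem HasVirtualSemiDiagonals.hasApproxSemiDiagonals (h : HasVirtualSemiDiagonals A) :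
    HasApproxSemiDiagonals A := by
  classical
  obtain ⟨M, N, hMN⟩ := h
  -- Helly's lemma must produce both nets at once, so `(M, N)` is viewed as one functional on the
  -- dual of the product, and `T a` collects the three defining expressions.
  let W : StrongDual ℂ (StrongDual ℂ (ProjTensorSq A × ProjTensorSq A)) :=
    M.comp ((ContinuousLinearMap.inl ℂ (ProjTensorSq A) (ProjTensorSq A)).precomp ℂ) +
      N.comp ((ContinuousLinearMap.inr ℂ (ProjTensorSq A) (ProjTensorSq A)).precomp ℂ)
  let T : A → (ProjTensorSq A × ProjTensorSq A →L[ℂ] A × A × ProjTensorSq A) := fun a =>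
    (((ContinuousLinearMap.mul ℂ A a).comp (prodMap A)).comp
      (.fst ℂ (ProjTensorSq A) (ProjTensorSq A))).prod
      (((((ContinuousLinearMap.mul ℂ A).flip a).comp (prodMap A)).comp
        (.snd ℂ (ProjTensorSq A) (ProjTensorSq A))).prod
        (((bimodule A).lact a).comp (.fst ℂ (ProjTensorSq A) (ProjTensorSq A)) -
          ((bimodule A).ract a).comp (.snd ℂ (ProjTensorSq A) (ProjTensorSq A))))
  have hW : ∀ (a : A) (ψ : StrongDual ℂ (A × A × ProjTensorSq A)),
      W (ψ.comp (T a)) = ψ (a, a, 0) := by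
    intro a ψ
    let ψ₁ : StrongDual ℂ A := ψ.comp (.inl ℂ A (A × ProjTensorSq A))
    let ψ₂ : StrongDual ℂ A :=
      (ψ.comp (.inr ℂ A (A × ProjTensorSq A))).comp (.inl ℂ A (ProjTensorSq A))
    let ψ₃ : StrongDual ℂ (ProjTensorSq A) :=
      (ψ.comp (.inr ℂ A (A × ProjTensorSq A))).comp (.inr ℂ A (ProjTensorSq A))
    have hψ : ∀ x y z, ψ (x, y, z) = ψ₁ x + ψ₂ y + ψ₃ z := by
      intro x y z
      simp only [ψ₁, ψ₂, ψ₃, ContinuousLinearMap.comp_apply, ContinuousLinearMap.inl_apply,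
        ContinuousLinearMap.inr_apply, ← map_add]
      simp
    have h1 : M (ψ₁.comp ((ContinuousLinearMap.mul ℂ A a).comp (prodMap A))) = ψ₁ a :=
      DFunLike.congr_fun (hMN a).1 ψ₁
    have h2 : N (ψ₂.comp (((ContinuousLinearMap.mul ℂ A).flip a).comp (prodMap A))) = ψ₂ a :=
      DFunLike.congr_fun (hMN a).2.1 ψ₂
    have h3 : M (ψ₃.comp ((bimodule A).lact a)) = N (ψ₃.comp ((bimodule A).ract a)) :=
      DFunLike.congr_fun (hMN a).2.2 ψ₃
    have e1 : (ψ.comp (T a)).comp (.inl ℂ (ProjTensorSq A) (ProjTensorSq A)) =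
        ψ₁.comp ((ContinuousLinearMap.mul ℂ A a).comp (prodMap A)) +
          ψ₃.comp ((bimodule A).lact a) := by
      ext t
      simp [T, hψ]
    have e2 : (ψ.comp (T a)).comp (.inr ℂ (ProjTensorSq A) (ProjTensorSq A)) =
        ψ₂.comp (((ContinuousLinearMap.mul ℂ A).flip a).comp (prodMap A)) -
          ψ₃.comp ((bimodule A).ract a) := by
      ext t
      simp [T, hψ, sub_eq_add_neg]
    change M ((ψ.comp (T a)).comp (.inl ℂ (ProjTensorSq A) (ProjTensorSq A))) +
      N ((ψ.comp (T a)).comp (.inr ℂ (ProjTensorSq A) (ProjTensorSq A))) = _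
    rw [e1, e2, map_add, map_sub, h1, h2, h3, hψ, map_zero]
    ring
  -- Helly's lemma for finitely many `a` simultaneously; the bound `‖W‖` does not depend on `F` or
  -- `k`, which makes the nets bounded.
  have key : ∀ (F : Finset A) (k : ℕ), ∃ z : ProjTensorSq A × ProjTensorSq A, ‖z‖ ≤ ‖W‖ ∧
      ∀ a ∈ F, ‖T a z - (a, a, 0)‖ < 1 / ((k : ℝ) + 1) := by
    intro F k
    obtain ⟨z, hz, hz'⟩ := exists_norm_le_norm_sub_lt_of_bidual
      (ContinuousLinearMap.pi fun a : F => T a) W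
      (fun a : F => ((a : A), (a : A), (0 : ProjTensorSq A)))
      (fun ψ => by
        have : ψ.comp (ContinuousLinearMap.pi fun a : F => T a) =
            ∑ a : F, (ψ.comp (ContinuousLinearMap.single ℂ _ a)).comp (T a) := by
          refine ContinuousLinearMap.ext fun z => ?_
          simp only [ContinuousLinearMap.comp_apply, sum_apply,
            ← map_sum]
          congr 1
          exact (Finset.univ_sum_single _).symm
        rw [this, map_sum]
        simp only [hW, ContinuousLinearMap.comp_apply, ← map_sum]
        congr 1
        exact Finset.univ_sum_single _) (ε := 1 / ((k : ℝ) + 1)) (by positivity)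
    exact ⟨z, hz, fun a ha => (norm_le_pi_norm _ (⟨a, ha⟩ : F)).trans_lt hz'⟩
  choose z hz hz' using key
  have hlim : ∀ a, Tendsto (fun i : Finset A × ℕ => T a (z i.1 i.2)) atTop (𝓝 (a, a, 0)) := by
    intro a
    rw [tendsto_iff_norm_sub_tendsto_zero]
    refine squeeze_zero' (Eventually.of_forall fun _ => norm_nonneg _) ?_
      (tendsto_one_div_add_atTop_nhds_zero_nat.comp
        ((prod_atTop_atTop_eq (α := Finset A) (β := ℕ)) ▸ tendsto_snd))
    filter_upwards [eventually_ge_atTop (({a} : Finset A), 0)] with i hi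
    exact (hz' i.1 i.2 a (hi.1 (Finset.mem_singleton_self a))).le
  refine ⟨Finset A × ℕ, inferInstance, inferInstance, inferInstance, fun i => (z i.1 i.2).1,
    fun i => (z i.1 i.2).2, ⟨‖W‖, fun i => (norm_fst_le _).trans (hz _ _)⟩,
    ⟨‖W‖, fun i => (norm_snd_le _).trans (hz _ _)⟩, fun a => ⟨?_, ?_, ?_⟩⟩
  · exact (continuous_fst.tendsto _).comp (hlim a)
  · exact ((continuous_fst.comp continuous_snd).tendsto _).comp (hlim a)
  · exact ((continuous_snd.comp continuous_snd).tendsto _).comp (hlim a)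
end

/-! ### Semi-diagonals from semi-amenability -/

section

variable {A : Type u} [NonUnitalNormedRing A] [NormedSpace ℂ A] [IsScalarTower ℂ A A]
  [SMulCommClass ℂ A A]

/-- With trivial right action on `A**`, the Leibniz rule only asks for a left module map, which the
canonical embedding is; a semi-inner map is then `a ↦ a · E`. -/
theorem IsSemiAmenable.exists_bidual_right_identity (h : IsSemiAmenable A) :
    ∃ E : StrongDual ℂ (StrongDual ℂ A), ∀ a,
      (BanachBimodule.self A).dual.dual.lact a E = NormedSpace.inclusionInDoubleDual ℂ A a := by
  obtain ⟨E, G, hE⟩ := h (StrongDual ℂ A) (BanachBimodule.self A).dual.rightPart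
    (NormedSpace.inclusionInDoubleDual ℂ A) (fun a b => by
      ext f
      simp only [add_apply]
      change f (a * b) = (NormedSpace.inclusionInDoubleDual ℂ A a) 0 + f (a * b)
      simp)
  refine ⟨E, fun a => ?_⟩
  rw [hE a]
  ext f
  change _ = _ - G 0
  rw [map_zero, sub_zero]
  rfl

theorem IsSemiAmenable.exists_bidual_left_identity (h : IsSemiAmenable A) :
    ∃ F : StrongDual ℂ (StrongDual ℂ A), ∀ a,
      (BanachBimodule.self A).dual.dual.ract a F = NormedSpace.inclusionInDoubleDual ℂ A a := by
  obtain ⟨G, F, hF⟩ := h (StrongDual ℂ A) (BanachBimodule.self A).dual.leftPart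
    (NormedSpace.inclusionInDoubleDual ℂ A) (fun a b => by
      ext f
      simp only [add_apply]
      change f (a * b) = f (a * b) + (NormedSpace.inclusionInDoubleDual ℂ A b) 0
      simp)
  -- The right action enters semi-inner maps with a minus sign.
  refine ⟨-F, fun a => ?_⟩
  rw [hF a, map_neg]
  ext f
  change _ = G 0 - _
  rw [map_zero, zero_sub]
  rfl

variable [CompleteSpace A]

/-- `π**(U ⊗ V)` is the first Arens product `UV`, and `a · (UV) = (a · U)V = a · V`. -/
theorem ProjTensorSq.self_lact_prodMapBidual_bidualTmul
    {U : StrongDual ℂ (StrongDual ℂ A)} (V : StrongDual ℂ (StrongDual ℂ A)) {a : A}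
    (hU : (BanachBimodule.self A).dual.dual.lact a U = NormedSpace.inclusionInDoubleDual ℂ A a) :
    (BanachBimodule.self A).dual.dual.lact a (prodMapBidual A (bidualTmul U V)) =
      (BanachBimodule.self A).dual.dual.lact a V := by
  ext f
  refine Eq.trans (congrArg U ?_) (DFunLike.congr_fun hU (V.comp
    ((ContinuousLinearMap.compL ℂ A A ℂ f).comp (ContinuousLinearMap.mul ℂ A))))
  ext b
  refine congrArg V ?_
  ext c
  change f (a * prodMap A (tmul b c)) = f (a * b * c)
  rw [prodMap_tmul, mul_assoc]

theorem ProjTensorSq.self_ract_prodMapBidual_bidualTmul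
    (U : StrongDual ℂ (StrongDual ℂ A)) {V : StrongDual ℂ (StrongDual ℂ A)} {a : A}
    (hV : (BanachBimodule.self A).dual.dual.ract a V = NormedSpace.inclusionInDoubleDual ℂ A a) :
    (BanachBimodule.self A).dual.dual.ract a (prodMapBidual A (bidualTmul U V)) =
      (BanachBimodule.self A).dual.dual.ract a U := by
  ext f
  refine congrArg U ?_
  ext b
  refine Eq.trans (congrArg V ?_)
    (DFunLike.congr_fun hV (f.comp (ContinuousLinearMap.mul ℂ A b)))
  ext c
  change f (prodMap A (tmul b c) * a) = f (b * (c * a))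
  rw [prodMap_tmul, mul_assoc]

theorem ProjTensorSq.prodMapBidual_sub_of_eq_zero
    (M : StrongDual ℂ (StrongDual ℂ (ProjTensorSq A)))
    {N : StrongDual ℂ (StrongDual ℂ (ProjTensorSq A))} (hN : prodMapBidual A N = 0) :
    prodMapBidual A (M - N) = prodMapBidual A M :=
  ContinuousLinearMap.ext fun f =>
    (congrArg (prodMapBidual A M f - ·) (DFunLike.congr_fun hN f)).trans (sub_zero _)

/-- The witness is `E + F - EF` in the Arens product: `a · EF = a · F` and `EF · a = E · a`, so the
unwanted terms cancel. -/
theorem IsSemiAmenable.exists_bidual_identity (h : IsSemiAmenable A) :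
    ∃ G : StrongDual ℂ (StrongDual ℂ A), ∀ a,
      (BanachBimodule.self A).dual.dual.lact a G = NormedSpace.inclusionInDoubleDual ℂ A a ∧
      (BanachBimodule.self A).dual.dual.ract a G = NormedSpace.inclusionInDoubleDual ℂ A a := by
  obtain ⟨E, hE⟩ := h.exists_bidual_right_identity
  obtain ⟨F, hF⟩ := h.exists_bidual_left_identity
  refine ⟨E + F - prodMapBidual A (bidualTmul E F), fun a => ⟨?_, ?_⟩⟩
  · rw [map_sub, map_add, self_lact_prodMapBidual_bidualTmul F (hE a), hE]
    abel
  · rw [map_sub, map_add, self_ract_prodMapBidual_bidualTmul E (hF a), hF]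
    abel

/-- If `π**` kills `a · M₀ - M₀ · a` for all `a`, then semi-amenability writes it as
`a · η - ξ · a` with `η`, `ξ` in the kernel of `π**`, which is the dual of the quotient of
`(A ⊗̂ A)*` by the closure of the range of `π*`. -/
theorem IsSemiAmenable.exists_prodMapBidual_eq_zero (h : IsSemiAmenable A)
    (M₀ : StrongDual ℂ (StrongDual ℂ (ProjTensorSq A)))
    (h₀ : ∀ a, prodMapBidual A ((bimodule A).dual.dual.lact a M₀) =
      prodMapBidual A ((bimodule A).dual.dual.ract a M₀)) :
    ∃ η ξ, prodMapBidual A η = 0 ∧ prodMapBidual A ξ = 0 ∧ ∀ a,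
      (bimodule A).dual.dual.lact a M₀ - (bimodule A).dual.dual.ract a M₀ =
        (bimodule A).dual.dual.lact a η - (bimodule A).dual.dual.ract a ξ := by
  let π' : StrongDual ℂ A →L[ℂ] StrongDual ℂ (ProjTensorSq A) := (prodMap A).precomp ℂ
  -- The closure makes the quotient a Banach space without changing the annihilator, which is the
  -- kernel of `π**`.
  let S : Submodule ℂ (StrongDual ℂ (ProjTensorSq A)) := π'.range.topologicalClosure
  have hS : IsClosed (S : Set (StrongDual ℂ (ProjTensorSq A))) :=
    Submodule.isClosed_topologicalClosure _
  have hπ : ∀ f, π' f ∈ S := fun f => Submodule.le_topologicalClosure _ ⟨f, rfl⟩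
  have hker : ∀ T : StrongDual ℂ (StrongDual ℂ (ProjTensorSq A)), prodMapBidual A T = 0 →
      ∀ s ∈ S, T s = 0 := by
    intro T hT s hs
    have : S ≤ T.ker := Submodule.topologicalClosure_minimal _
      (by rintro _ ⟨f, rfl⟩; exact DFunLike.congr_fun hT f) T.isClosed_ker
    exact this hs
  have hl : ∀ a, ∀ s ∈ S, (bimodule A).dual.lact a s ∈ S := by
    intro a
    have : S ≤ S.comap ((bimodule A).dual.lact a).toLinearMap :=
      Submodule.topologicalClosure_minimal _ (by
        rintro _ ⟨f, rfl⟩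
        have e : (bimodule A).dual.lact a (π' f) =
            π' ((BanachBimodule.self A).dual.lact a f) :=
          ContinuousLinearMap.ext fun t => congrArg f (prodMap_ract a t)
        exact Set.mem_of_eq_of_mem (s := (S : Set _)) e (hπ _))
        (hS.preimage ((bimodule A).dual.lact a).continuous)
    exact this
  have hr : ∀ a, ∀ s ∈ S, (bimodule A).dual.ract a s ∈ S := by
    intro a
    have : S ≤ S.comap ((bimodule A).dual.ract a).toLinearMap :=
      Submodule.topologicalClosure_minimal _ (by
        rintro _ ⟨f, rfl⟩
        have e : (bimodule A).dual.ract a (π' f) =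
            π' ((BanachBimodule.self A).dual.ract a f) :=
          ContinuousLinearMap.ext fun t => congrArg f (prodMap_lact a t)
        exact Set.mem_of_eq_of_mem (s := (S : Set _)) e (hπ _))
        (hS.preimage ((bimodule A).dual.ract a).continuous)
    exact this
  let D₀ : A →L[ℂ] StrongDual ℂ (StrongDual ℂ (ProjTensorSq A)) :=
    (bimodule A).dual.dual.lact.flip M₀ - (bimodule A).dual.dual.ract.flip M₀
  have hD₀ : (bimodule A).dual.dual.IsDerivation D₀ := by
    intro a b
    have e := (bimodule A).dual.dual.lact_ract a b M₀
    simp only [D₀, sub_apply, ContinuousLinearMap.flip_apply, map_sub,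
      (bimodule A).dual.dual.lact_mul, (bimodule A).dual.dual.ract_mul, e]
    abel
  -- `D₀` vanishes on `S` by `h₀`, so it descends to the dual of the quotient.
  let D : A →L[ℂ] StrongDual ℂ (StrongDual ℂ (ProjTensorSq A) ⧸ S) :=
    S.liftQL₂ D₀ fun a s hs => hker _
      (ContinuousLinearMap.ext fun f => sub_eq_zero.2 (DFunLike.congr_fun (h₀ a) f)) s hs
  obtain ⟨η, ξ, hηξ⟩ := h _ ((bimodule A).dual.quotient S hl hr) D (by
    intro a b
    ext x
    obtain ⟨x, rfl⟩ := S.mkQ_surjective x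
    exact DFunLike.congr_fun (hD₀ a b) x)
  have hz : ∀ f, S.mkQL (π' f) = 0 := fun f => (Submodule.Quotient.mk_eq_zero S).2 (hπ f)
  refine ⟨η.comp S.mkQL, ξ.comp S.mkQL, ?_, ?_, fun a => ?_⟩
  · ext f
    exact (congrArg η (hz f)).trans (map_zero η)
  · ext f
    exact (congrArg ξ (hz f)).trans (map_zero ξ)
  · ext x
    exact DFunLike.congr_fun (hηξ a) (S.mkQL x)

theorem IsSemiAmenable.hasVirtualSemiDiagonals (h : IsSemiAmenable A) :
    HasVirtualSemiDiagonals A := by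
  obtain ⟨G, hG⟩ := h.exists_bidual_identity
  have hl : ∀ a, (BanachBimodule.self A).dual.dual.lact a (prodMapBidual A (bidualTmul G G)) =
      NormedSpace.inclusionInDoubleDual ℂ A a := fun a =>
    (self_lact_prodMapBidual_bidualTmul G (hG a).1).trans (hG a).1
  have hr : ∀ a, (BanachBimodule.self A).dual.dual.ract a (prodMapBidual A (bidualTmul G G)) =
      NormedSpace.inclusionInDoubleDual ℂ A a := fun a =>
    (self_ract_prodMapBidual_bidualTmul G (hG a).2).trans (hG a).2
  obtain ⟨η, ξ, hη, hξ, hηξ⟩ := h.exists_prodMapBidual_eq_zero (bidualTmul G G) fun a => by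
    rw [prodMapBidual_lact, prodMapBidual_ract, hl, hr]
  refine ⟨bidualTmul G G - η, bidualTmul G G - ξ, fun a => ⟨?_, ?_, ?_⟩⟩
  · rw [prodMapBidual_sub_of_eq_zero _ hη, hl]
  · rw [prodMapBidual_sub_of_eq_zero _ hξ, hr]
  · rw [map_sub, map_sub, sub_eq_sub_iff_sub_eq_sub, hηξ]

end

end

theorem theorem2p19 (A : Type u) [NonUnitalNormedRing A] [NormedSpace ℂ A]
    [IsScalarTower ℂ A A] [SMulCommClass ℂ A A] [CompleteSpace A] :
    List.TFAE [IsSemiAmenable A, HasApproxSemiDiagonals A, HasVirtualSemiDiagonals A] := by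
  tfae_have 1 → 3 := IsSemiAmenable.hasVirtualSemiDiagonals
  tfae_have 3 → 1 := HasVirtualSemiDiagonals.isSemiAmenable
  tfae_have 2 → 3 := HasApproxSemiDiagonals.hasVirtualSemiDiagonals
  tfae_have 3 → 2 := HasVirtualSemiDiagonals.hasApproxSemiDiagonals
  tfae_finish
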